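/- **Setting.** Let $Y,X,W_2$ be real random variables and $W_1$ an $\mathbb{R}^{d}$-valued random vector on a common probability space; $(Y,X,W_1)$ is observed, $W_2$ is not. All regressions are population OLS regressions with an intercept, and the R-squared is the variance of the fitted value divided by $\operatorname{var}(Y)$. Let $\beta_{\text{short}}$ be the coefficient on $X$ in the regression of $Y$ on $(1,X)$; let $\beta_{\text{med}},\gamma_{1,\text{med}}$ be the coefficients on $X,W_1$ and $R^2_{\text{med}}$ the R-squared in the regression of $Y$ on $(1,X,W_1)$; let $\beta_{\text{long}},\gamma_{1,\text{long}},\gamma_{2,\text{long}}$ be the coefficients on $X,W_1,W_2$ and $R^2_{\text{long}}$ the R-squared in the regression of $Y$ on $(1,X,W_1,W_2)$; let $\pi_1$ be the coefficient on $W_1$ in the regression of $X$ on $(1,W_1)$, and $X^{\perp W_1}=X-\pi_1'W_1$. **Assumptions.** - (A1) $\operatorname{var}(Y,X,W_1,W_2)$ is finite; $\operatorname{var}(X,W_1,W_2)$ and $\operatorname{var}(Y,X,W_1)$ are positive definite. - (A2) $\delta\in\mathbb{R}$ satisfies $\displaystyle \delta\cdot\frac{\operatorname{cov}(X,\gamma_{1,\text{long}}'W_1)}{\operatorname{var}(\gamma_{1,\text{long}}'W_1)}=\frac{\operatorname{cov}(X,\gamma_{2,\text{long}}W_2)}{\operatorname{var}(\gamma_{2,\text{long}}W_2)}$.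 - (A3) $\gamma_{1,\text{long}}\neq 0$ and $\gamma_{2,\text{long}}\neq 0$. - (A4) $\operatorname{cov}(W_1,W_2)=0$. - (A5) $\operatorname{var}(W_2)=1$. **Notation.** Put $$f_0(B)=-B\operatorname{var}(X^{\perp W_1})\left(\operatorname{var}(\gamma_{1,\text{med}}'W_1)+2B\operatorname{cov}(X,\gamma_{1,\text{med}}'W_1)+B^2\operatorname{var}(\pi_1'W_1)\right),$$ $$\begin{aligned}f_1(B,R^2)={}&(R^2-R^2_{\text{med}})\operatorname{var}(Y)\operatorname{cov}(X,\gamma_{1,\text{med}}'W_1)+B(R^2-R^2_{\text{med}})\operatorname{var}(Y)\operatorname{var}(\pi_1'W_1)\\&+B^2\operatorname{var}(X^{\perp W_1})\operatorname{cov}(X,\gamma_{1,\text{med}}'W_1)+B^3\operatorname{var}(X^{\perp W_1})\operatorname{var}(\pi_1'W_1),\end{aligned}$$ $$\mathcal{B}_{\text{A3fail}}=\{b\in\mathbb{R}:\gamma_{1,\text{med}}+(\beta_{\text{med}}-b)\pi_1=0\},$$ $$\mathcal{B}_I(\delta,R^2)=\{b\in\mathbb{R}:f_0(\beta_{\text{med}}-b)+\delta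 f_1(\beta_{\text{med}}-b,R^2)=0\}\setminus\mathcal{B}_{\text{A3fail}},$$ $$\delta^{\text{bp},=}(b,R^2)=\inf\{|\delta|:\delta\in\mathbb{R},\ b\in\mathcal{B}_I(\delta,R^2)\}\qquad(\inf\emptyset=+\infty).$$ Call $(\delta,R^2,b)$ *compatible* with the distribution of $(Y,X,W_1)$ if there is a joint distribution of $(Y,X,W_1,W_2)$ with that marginal which satisfies A1–A5 with this $\delta$, has $R^2_{\text{long}}=R^2$, and has $\beta_{\text{long}}=b$. **Theorem.** Suppose A1–A5 hold with $\delta$, that $R^2_{\text{long}}\in(R^2_{\text{med}},1]$, that $\beta_{\text{long}}=\beta_{\text{hypo}}\in\mathbb{R}\setminus\mathcal{B}_{\text{A3fail}}$, and that $\beta_{\text{short}}\neq\beta_{\text{med}}$. Then $f_1(\beta_{\text{med}}-\beta_{\text{hypo}},R^2_{\text{long}})\neq 0$, and given the distribution of $(Y,X,W_1)$, $R^2_{\text{long}}$ and $\beta_{\text{long}}=\beta_{\text{hypo}}$, the parameter $\delta$ is point identified: the set of all $\delta'\in\mathbb{R}$ for which $(\delta',R^2_{\text{long}},\beta_{\text{hypo}})$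 is compatible with the distribution of $(Y,X,W_1)$ is a singleton, and $$\delta=\frac{-f_0(\beta_{\text{med}}-\beta_{\text{hypo}})}{f_1(\beta_{\text{med}}-\beta_{\text{hypo}},R^2_{\text{long}})}$$ is its only element. Consequently $$\delta^{\text{bp},=}(\beta_{\text{hypo}},R^2_{\text{long}})=\left|\frac{-f_0(\beta_{\text{med}}-\beta_{\text{hypo}})}{f_1(\beta_{\text{med}}-\beta_{\text{hypo}},R^2_{\text{long}})}\right|,$$ and the same equality holds when $\mathcal{B}_I(\delta,R^2)$ in the definition of $\delta^{\text{bp},=}$ is replaced by the identified set of $\beta_{\text{long}}$, that is, by the set of all $b$ for which $(\delta,R^2,b)$ is compatible with the distribution of $(Y,X,W_1)$. -/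

import Mathlib

open MeasureTheory ProbabilityTheory
open scoped Matrix

noncomputable section

namespace Oster

variable {Ω : Type*} [MeasurableSpace Ω]

/-! ### Population OLS -/

/-- The linear index `g'V`. -/
def lin {ι : Type*} [Fintype ι] (g : ι → ℝ) (V : ι → Ω → ℝ) : Ω → ℝ :=
  fun ω => ∑ i, g i * V i ω

/-- The variance matrix `var(V)` of the random vector `V`. -/
def varMatrix {ι : Type*} (P : Measure Ω) (V : ι → Ω → ℝ) : Matrix ι ι ℝ :=
  Matrix.of fun i j => cov[V i, V j; P]

/-- The slope coefficients `var(V)⁻¹ cov(V, Y)` of the population OLS regression of `Y` on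
`(1, V)`. -/
def olsCoef {ι : Type*} [Fintype ι] [DecidableEq ι] (P : Measure Ω) (Y : Ω → ℝ)
    (V : ι → Ω → ℝ) : ι → ℝ :=
  (varMatrix P V)⁻¹ *ᵥ fun i => cov[V i, Y; P]

/-- The population R-squared of the regression of `Y` on `(1, V)`: the variance of the fitted
value divided by the variance of `Y`. -/
def rSquared {ι : Type*} [Fintype ι] [DecidableEq ι] (P : Measure Ω) (Y : Ω → ℝ)
    (V : ι → Ω → ℝ) : ℝ :=
  Var[lin (olsCoef P Y V) V; P] / Var[Y; P]

variable {d : ℕ}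

/-- The regressor `X`, as a vector of length one. -/
def shortRegs (X : Ω → ℝ) : Unit → Ω → ℝ := fun _ => X

/-- The regressors `(X, W₁)`. -/
def medRegs (X : Ω → ℝ) (W₁ : Fin d → Ω → ℝ) : Unit ⊕ Fin d → Ω → ℝ :=
  Sum.elim (fun _ => X) W₁

/-- The regressors `(X, W₁, W₂)`, with scalar `W₂`. -/
def longRegs (X : Ω → ℝ) (W₁ : Fin d → Ω → ℝ) (W₂ : Ω → ℝ) :
    Unit ⊕ (Fin d ⊕ Unit) → Ω → ℝ :=
  Sum.elim (fun _ => X) (Sum.elim W₁ fun _ => W₂)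

/-! ### Short and medium regressions (functions of the distribution of `(Y, X, W₁)`) -/

def betaShort (P : Measure Ω) (Y X : Ω → ℝ) : ℝ := olsCoef P Y (shortRegs X) ()

def betaMed (P : Measure Ω) (Y X : Ω → ℝ) (W₁ : Fin d → Ω → ℝ) : ℝ :=
  olsCoef P Y (medRegs X W₁) (Sum.inl ())

def gammaOneMed (P : Measure Ω) (Y X : Ω → ℝ) (W₁ : Fin d → Ω → ℝ) : Fin d → ℝ :=
  fun i => olsCoef P Y (medRegs X W₁) (Sum.inr i)

def rSqMed (P : Measure Ω) (Y X : Ω → ℝ) (W₁ : Fin d → Ω → ℝ) : ℝ :=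
  rSquared P Y (medRegs X W₁)

/-- The coefficients on `W₁` in the regression of `X` on `(1, W₁)`. -/
def piOne (P : Measure Ω) (X : Ω → ℝ) (W₁ : Fin d → Ω → ℝ) : Fin d → ℝ := olsCoef P X W₁

/-- `X - π₁'W₁`. -/
def xPerp (P : Measure Ω) (X : Ω → ℝ) (W₁ : Fin d → Ω → ℝ) : Ω → ℝ :=
  fun ω => X ω - lin (piOne P X W₁) W₁ ω

/-! ### Long regression -/

def betaLong (P : Measure Ω) (Y X : Ω → ℝ) (W₁ : Fin d → Ω → ℝ) (W₂ : Ω → ℝ) : ℝ :=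
  olsCoef P Y (longRegs X W₁ W₂) (Sum.inl ())

def gammaOneLong (P : Measure Ω) (Y X : Ω → ℝ) (W₁ : Fin d → Ω → ℝ) (W₂ : Ω → ℝ) :
    Fin d → ℝ :=
  fun i => olsCoef P Y (longRegs X W₁ W₂) (Sum.inr (Sum.inl i))

def gammaTwoLong (P : Measure Ω) (Y X : Ω → ℝ) (W₁ : Fin d → Ω → ℝ) (W₂ : Ω → ℝ) : ℝ :=
  olsCoef P Y (longRegs X W₁ W₂) (Sum.inr (Sum.inr ()))

def rSqLong (P : Measure Ω) (Y X : Ω → ℝ) (W₁ : Fin d → Ω → ℝ) (W₂ : Ω → ℝ) : ℝ :=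
  rSquared P Y (longRegs X W₁ W₂)

/-! ### The assumptions -/

/-- Assumptions A1 to A5 for the random variables `(Y, X, W₁, W₂)` and the number `δ`. -/
structure Assumptions (P : Measure Ω) (Y X : Ω → ℝ) (W₁ : Fin d → Ω → ℝ) (W₂ : Ω → ℝ)
    (δ : ℝ) : Prop where
  /-- A1: finite second moments. -/
  memLp_Y : MemLp Y 2 P
  memLp_X : MemLp X 2 P
  memLp_W₁ : ∀ i, MemLp (W₁ i) 2 P
  memLp_W₂ : MemLp W₂ 2 P
  /-- A1: `var(X, W₁, W₂)` is positive definite. -/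
  posDef_long : (varMatrix P (longRegs X W₁ W₂)).PosDef
  /-- A1: `var(Y, X, W₁)` is positive definite. -/
  posDef_obs : (varMatrix P (Sum.elim (fun _ : Unit => Y) (medRegs X W₁))).PosDef
  /-- A2: `δ` scales selection on observables to selection on unobservables. -/
  selection :
    δ * (cov[X, lin (gammaOneLong P Y X W₁ W₂) W₁; P] /
        Var[lin (gammaOneLong P Y X W₁ W₂) W₁; P]) =
      cov[X, fun ω => gammaTwoLong P Y X W₁ W₂ * W₂ ω; P] /
        Var[fun ω => gammaTwoLong P Y X W₁ W₂ * W₂ ω; P]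
  /-- A3. -/
  gammaOne_ne : gammaOneLong P Y X W₁ W₂ ≠ 0
  gammaTwo_ne : gammaTwoLong P Y X W₁ W₂ ≠ 0
  /-- A4: exogenous controls. -/
  exog : ∀ i, cov[W₁ i, W₂; P] = 0
  /-- A5: normalization. -/
  norm_W₂ : Var[W₂; P] = 1

/-! ### Identified sets -/

/-- The joint distribution of the observables `(Y, X, W₁)`. -/
def obsLaw (P : Measure Ω) (Y X : Ω → ℝ) (W₁ : Fin d → Ω → ℝ) :
    Measure (ℝ × ℝ × (Fin d → ℝ)) :=
  P.map fun ω => (Y ω, X ω, fun i => W₁ i ω)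

/-- The values `(δ, R², b)` are compatible with the distribution `L` of the observables: some
joint distribution `Q` of `(Y, X, W₁, W₂)` has `L` as its marginal for `(Y, X, W₁)`, satisfies
A1 to A5 with this `δ`, and has long R-squared `R²` and long coefficient `b`. -/
def Compatible (L : Measure (ℝ × ℝ × (Fin d → ℝ))) (δ R2 b : ℝ) : Prop :=
  ∃ Q : Measure (ℝ × ℝ × (Fin d → ℝ) × ℝ), IsProbabilityMeasure Q ∧
    obsLaw Q (fun q => q.1) (fun q => q.2.1) (fun i q => q.2.2.1 i) = L ∧
    Assumptions Q (fun q => q.1) (fun q => q.2.1) (fun i q => q.2.2.1 i) (fun q => q.2.2.2) δ ∧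
    rSqLong Q (fun q => q.1) (fun q => q.2.1) (fun i q => q.2.2.1 i) (fun q => q.2.2.2) = R2 ∧
    betaLong Q (fun q => q.1) (fun q => q.2.1) (fun i q => q.2.2.1 i) (fun q => q.2.2.2) = b

/-- The identified set for `δ` when the distribution of the observables, the long R-squared and
the long coefficient are known. -/
def idSetDelta (L : Measure (ℝ × ℝ × (Fin d → ℝ))) (R2 b : ℝ) : Set ℝ :=
  {δ | Compatible L δ R2 b}

/-- The identified set for the long coefficient when the distribution of the observables, `δ` and
the long R-squared are known. -/
def idSetBeta (L : Measure (ℝ × ℝ × (Fin d → ℝ))) (δ R2 : ℝ) : Set ℝ :=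
  {b | Compatible L δ R2 b}

/-! ### The functions `f₀`, `f₁`, `f`, and the closed-form set -/

def fZero (P : Measure Ω) (Y X : Ω → ℝ) (W₁ : Fin d → Ω → ℝ) (B : ℝ) : ℝ :=
  -B * Var[xPerp P X W₁; P] *
    (Var[lin (gammaOneMed P Y X W₁) W₁; P]
      + 2 * B * cov[X, lin (gammaOneMed P Y X W₁) W₁; P]
      + B ^ 2 * Var[lin (piOne P X W₁) W₁; P])

def fOne (P : Measure Ω) (Y X : Ω → ℝ) (W₁ : Fin d → Ω → ℝ) (B R2 : ℝ) : ℝ :=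
  (R2 - rSqMed P Y X W₁) * Var[Y; P] * cov[X, lin (gammaOneMed P Y X W₁) W₁; P]
    + B * (R2 - rSqMed P Y X W₁) * Var[Y; P] * Var[lin (piOne P X W₁) W₁; P]
    + B ^ 2 * Var[xPerp P X W₁; P] * cov[X, lin (gammaOneMed P Y X W₁) W₁; P]
    + B ^ 3 * Var[xPerp P X W₁; P] * Var[lin (piOne P X W₁) W₁; P]

def fOster (P : Measure Ω) (Y X : Ω → ℝ) (W₁ : Fin d → Ω → ℝ) (B δ R2 : ℝ) : ℝ :=
  fZero P Y X W₁ B + δ * fOne P Y X W₁ B R2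

/-- The values of the long coefficient that would force the long coefficients on `W₁` to
vanish. -/
def A3fail (P : Measure Ω) (Y X : Ω → ℝ) (W₁ : Fin d → Ω → ℝ) : Set ℝ :=
  {b | gammaOneMed P Y X W₁ + (betaMed P Y X W₁ - b) • piOne P X W₁ = 0}

/-- The closed-form set `B_I(δ, R²)`. -/
def setBI (P : Measure Ω) (Y X : Ω → ℝ) (W₁ : Fin d → Ω → ℝ) (δ R2 : ℝ) : Set ℝ :=
  {b | fOster P Y X W₁ (betaMed P Y X W₁ - b) δ R2 = 0} \ A3fail P Y X W₁

/-- The exact value breakdown point at `b` of a family `δ ↦ 𝓑 δ` of sets of coefficients: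
the infimum of `|δ|` over all real `δ` with `b ∈ 𝓑 δ` (`⊤` if there is none). -/
def exactBreakdown (𝓑 : ℝ → Set ℝ) (b : ℝ) : EReal :=
  sInf ((fun δ : ℝ => ((|δ| : ℝ) : EReal)) '' {δ | b ∈ 𝓑 δ})

end Oster

end

/-! The whole theorem reduces to one scalar equation. Write B = β_med − β_long. Exogeneity of W₂
gives γ₁,long = γ₁,med + B π₁ (`gammaOneLong_eq`). The normal equation for X then gives B
var(X^{⊥W₁}) = γ₂ cov(X, W₂) (`omitted_variable_bias`), and the two R-squareds determine γ₂²
(`gammaTwoLong_sq`). With these, f₀(B) = −B var(X^{⊥W₁}) var(γ₁,long'W₁) and f₁(B, R²) = γ₂² cov(X,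
γ₁,long'W₁), so A2 with cleared denominators says δ f₁ = −f₀ (`mul_fOne_eq_neg_fZero`).

If f₁ vanished, so would f₀, hence B; but at B = 0, f₁ is γ₂² (β_short − β_med) var(X), which is
nonzero. So the equation determines δ.

The coefficients of this equation are functionals of the law of (Y, X, W₁), so every compatible δ'
solves the same equation. Conversely, the joint law of the given variables witnesses compatibility
of δ. Both breakdown points are therefore infima over a singleton. -/

namespace Oster

open MeasureTheory ProbabilityTheory Matrix

/-! ### Covariance algebra of linear indices and OLS normal equations -/

section Lin

variable {Ω : Type*} [MeasurableSpace Ω] {P : Measure Ω} {ι : Type*} [Fintype ι]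

theorem memLp_lin {V : ι → Ω → ℝ} (hV : ∀ i, MemLp (V i) 2 P) (g : ι → ℝ) :
    MemLp (lin g V) 2 P :=
  memLp_finsetSum _ fun i _ => (hV i).const_mul (g i)

theorem covariance_lin_left [IsFiniteMeasure P] {V : ι → Ω → ℝ} {Z : Ω → ℝ}
    (hV : ∀ i, MemLp (V i) 2 P) (hZ : MemLp Z 2 P) (g : ι → ℝ) :
    cov[lin g V, Z; P] = ∑ i, g i * cov[V i, Z; P] := by
  unfold lin
  rw [covariance_fun_sum_left (fun i => (hV i).const_mul (g i)) hZ]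
  simp_rw [covariance_const_mul_left]

theorem covariance_lin_right [IsFiniteMeasure P] {V : ι → Ω → ℝ} {Z : Ω → ℝ}
    (hV : ∀ i, MemLp (V i) 2 P) (hZ : MemLp Z 2 P) (g : ι → ℝ) :
    cov[Z, lin g V; P] = ∑ i, g i * cov[Z, V i; P] := by
  rw [covariance_comm, covariance_lin_left hV hZ]
  simp_rw [covariance_comm Z]

/-- A nontrivial linear index of a random vector with positive definite variance has positive
variance. -/
theorem variance_lin_pos [IsFiniteMeasure P] {V : ι → Ω → ℝ} (hV : ∀ i, MemLp (V i) 2 P)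
    (hpd : (varMatrix P V).PosDef) {g : ι → ℝ} (hg : g ≠ 0) : 0 < cov[lin g V, lin g V; P] := by
  have h := hpd.dotProduct_mulVec_pos hg
  rw [covariance_lin_left hV (memLp_lin hV g)]
  simp_rw [covariance_lin_right hV (hV _)]
  simpa [dotProduct, mulVec, varMatrix, mul_comm] using h

/-- The normal equations of the population OLS regression. -/
theorem covariance_fitted [IsFiniteMeasure P] [DecidableEq ι] {V : ι → Ω → ℝ} (Y : Ω → ℝ)
    (hV : ∀ i, MemLp (V i) 2 P) (hpd : (varMatrix P V).PosDef) (i : ι) :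
    cov[V i, lin (olsCoef P Y V) V; P] = cov[V i, Y; P] := by
  have h : varMatrix P V *ᵥ olsCoef P Y V = fun i => cov[V i, Y; P] := by
    rw [olsCoef, mulVec_mulVec, mul_nonsing_inv _ ((isUnit_iff_isUnit_det _).1 hpd.isUnit),
      one_mulVec]
  rw [covariance_lin_right hV (hV i), ← congrFun h i]
  simp [mulVec, dotProduct, varMatrix, mul_comm]

/-- The residual of an OLS regression is uncorrelated with every linear index of the regressors. -/
theorem covariance_lin_fitted [IsFiniteMeasure P] [DecidableEq ι] {V : ι → Ω → ℝ} {Y : Ω → ℝ}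
    (hY : MemLp Y 2 P) (hV : ∀ i, MemLp (V i) 2 P) (hpd : (varMatrix P V).PosDef) (g : ι → ℝ) :
    cov[lin g V, lin (olsCoef P Y V) V; P] = cov[lin g V, Y; P] := by
  rw [covariance_lin_left hV (memLp_lin hV _), covariance_lin_left hV hY]
  simp_rw [covariance_fitted Y hV hpd]

/-- The fitted value is uncorrelated with the residual. The right-hand side is linear in the
coefficients, which makes the medium and long R-squareds easy to compare. -/
theorem rSquared_mul_variance [IsFiniteMeasure P] [DecidableEq ι] {V : ι → Ω → ℝ} {Y : Ω → ℝ}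
    (hY : MemLp Y 2 P) (hV : ∀ i, MemLp (V i) 2 P) (hpd : (varMatrix P V).PosDef)
    (hvar : Var[Y; P] ≠ 0) :
    rSquared P Y V * Var[Y; P] = cov[lin (olsCoef P Y V) V, Y; P] := by
  rw [rSquared, div_mul_cancel₀ _ hvar, ← covariance_lin_fitted hY hV hpd,
    covariance_self (memLp_lin hV _).aemeasurable]

end Lin

/-! ### Splitting the regressor vectors into blocks -/

section Regressors

variable {Ω Ω' : Type*} {d : ℕ}

theorem lin_medRegs (X : Ω → ℝ) (W₁ : Fin d → Ω → ℝ) (c : Unit ⊕ Fin d → ℝ) :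
    lin c (medRegs X W₁) =
      (c (Sum.inl ()) • X + lin (fun i => c (Sum.inr i)) W₁ : Ω → ℝ) := by
  ext ω
  simp [lin, medRegs]

theorem lin_longRegs (X : Ω → ℝ) (W₁ : Fin d → Ω → ℝ) (W₂ : Ω → ℝ)
    (c : Unit ⊕ (Fin d ⊕ Unit) → ℝ) :
    lin c (longRegs X W₁ W₂) =
      (c (Sum.inl ()) • X + (lin (fun i => c (Sum.inr (Sum.inl i))) W₁ +
        c (Sum.inr (Sum.inr ())) • W₂) : Ω → ℝ) := by
  ext ω
  simp [lin, longRegs]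

theorem medRegs_comp (X : Ω' → ℝ) (W₁ : Fin d → Ω' → ℝ) (T : Ω → Ω') :
    (fun i => medRegs X W₁ i ∘ T) = medRegs (X ∘ T) fun i => W₁ i ∘ T := by
  funext i
  rcases i with _ | _ <;> rfl

theorem longRegs_comp (X : Ω' → ℝ) (W₁ : Fin d → Ω' → ℝ) (W₂ : Ω' → ℝ) (T : Ω → Ω') :
    (fun i => longRegs X W₁ W₂ i ∘ T) = longRegs (X ∘ T) (fun i => W₁ i ∘ T) (W₂ ∘ T) := by
  funext i
  rcases i with _ | _ | _ <;> rfl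

/-- The coefficient 1 on X makes this index nontrivial, so positive definiteness applies to it. -/
theorem xPerp_eq_lin [MeasurableSpace Ω] (P : Measure Ω) (X : Ω → ℝ) (W₁ : Fin d → Ω → ℝ) :
    xPerp P X W₁ = lin (Sum.elim (fun _ => 1) (-piOne P X W₁)) (medRegs X W₁) := by
  ext ω
  simp [xPerp, lin, medRegs, sub_eq_add_neg]

end Regressors

/-! ### Consequences of A1–A5 for one model -/

section Core

variable {Ω : Type*} [MeasurableSpace Ω] {P : Measure Ω} {d : ℕ}
  {Y X : Ω → ℝ} {W₁ : Fin d → Ω → ℝ} {W₂ : Ω → ℝ} {δ : ℝ}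

namespace Assumptions

variable (hA : Assumptions P Y X W₁ W₂ δ)
include hA

theorem memLp_medRegs : ∀ i, MemLp (medRegs X W₁ i) 2 P := by
  rintro (_ | i)
  exacts [hA.memLp_X, hA.memLp_W₁ i]

theorem memLp_longRegs : ∀ i, MemLp (longRegs X W₁ W₂ i) 2 P := by
  rintro (_ | _ | _)
  exacts [hA.memLp_X, hA.memLp_W₁ _, hA.memLp_W₂]

theorem posDef_med : (varMatrix P (medRegs X W₁)).PosDef :=
  hA.posDef_obs.submatrix Sum.inr_injective

theorem posDef_short : (varMatrix P (shortRegs X)).PosDef :=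
  hA.posDef_med.submatrix Sum.inl_injective

theorem posDef_controls : (varMatrix P W₁).PosDef :=
  hA.posDef_med.submatrix Sum.inr_injective

theorem variance_outcome_pos : 0 < Var[Y; P] := by
  rw [← covariance_self hA.memLp_Y.aemeasurable]
  exact hA.posDef_obs.diag_pos (i := Sum.inl ())

theorem variance_treatment_pos : 0 < cov[X, X; P] := hA.posDef_med.diag_pos (i := Sum.inl ())

variable [IsProbabilityMeasure P]

theorem variance_xPerp_pos : 0 < Var[xPerp P X W₁; P] := by
  rw [xPerp_eq_lin, ← covariance_self (memLp_lin hA.memLp_medRegs _).aemeasurable]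
  refine variance_lin_pos hA.memLp_medRegs hA.posDef_med fun h => ?_
  simpa using congrFun h (Sum.inl ())

theorem covariance_med (Z : Ω → ℝ) (hZ : MemLp Z 2 P) :
    cov[Z, lin (olsCoef P Y (medRegs X W₁)) (medRegs X W₁); P] =
      betaMed P Y X W₁ * cov[Z, X; P] + cov[Z, lin (gammaOneMed P Y X W₁) W₁; P] := by
  rw [lin_medRegs, covariance_add_right hZ (hA.memLp_X.const_smul _) (memLp_lin hA.memLp_W₁ _),
    covariance_smul_right]
  rfl

theorem covariance_long (Z : Ω → ℝ) (hZ : MemLp Z 2 P) :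
    cov[Z, lin (olsCoef P Y (longRegs X W₁ W₂)) (longRegs X W₁ W₂); P] =
      betaLong P Y X W₁ W₂ * cov[Z, X; P] +
        (cov[Z, lin (gammaOneLong P Y X W₁ W₂) W₁; P] +
          gammaTwoLong P Y X W₁ W₂ * cov[Z, W₂; P]) := by
  rw [lin_longRegs, covariance_add_right hZ (hA.memLp_X.const_smul _)
      ((memLp_lin hA.memLp_W₁ _).add (hA.memLp_W₂.const_smul _)),
    covariance_add_right hZ (memLp_lin hA.memLp_W₁ _) (hA.memLp_W₂.const_smul _),
    covariance_smul_right, covariance_smul_right]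
  rfl

theorem covariance_lin_W₂ (g : Fin d → ℝ) : cov[lin g W₁, W₂; P] = 0 := by
  rw [covariance_lin_left hA.memLp_W₁ hA.memLp_W₂]
  simp [hA.exog]

/-- `cov(g'W₁, π₁'W₁) = cov(g'W₁, X)`. -/
theorem covariance_lin_piOne (g : Fin d → ℝ) :
    cov[lin g W₁, lin (piOne P X W₁) W₁; P] = cov[lin g W₁, X; P] :=
  covariance_lin_fitted hA.memLp_X hA.memLp_W₁ hA.posDef_controls g

theorem covariance_lin_outcome_med (g : Fin d → ℝ) :
    cov[lin g W₁, Y; P] = betaMed P Y X W₁ * cov[lin g W₁, X; P] +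
      cov[lin g W₁, lin (gammaOneMed P Y X W₁) W₁; P] := by
  rw [← hA.covariance_med _ (memLp_lin hA.memLp_W₁ g), covariance_lin_left hA.memLp_W₁ hA.memLp_Y,
    covariance_lin_left hA.memLp_W₁ (memLp_lin hA.memLp_medRegs _)]
  exact Finset.sum_congr rfl fun i _ => congrArg _
    (covariance_fitted Y hA.memLp_medRegs hA.posDef_med (Sum.inr i)).symm

/-- A4 removes the W₂ term, leaving the same form as the medium equation; subtracting the two
isolates γ₁,long − γ₁,med. -/
theorem covariance_lin_outcome_long (g : Fin d → ℝ) :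
    cov[lin g W₁, Y; P] = betaLong P Y X W₁ W₂ * cov[lin g W₁, X; P] +
      cov[lin g W₁, lin (gammaOneLong P Y X W₁ W₂) W₁; P] := by
  have h := hA.covariance_long _ (memLp_lin hA.memLp_W₁ g)
  rw [hA.covariance_lin_W₂, mul_zero, add_zero] at h
  rw [← h, covariance_lin_left hA.memLp_W₁ hA.memLp_Y,
    covariance_lin_left hA.memLp_W₁ (memLp_lin hA.memLp_longRegs _)]
  exact Finset.sum_congr rfl fun i _ => congrArg _
    (covariance_fitted Y hA.memLp_longRegs hA.posDef_long (Sum.inr (Sum.inl i))).symm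

theorem covariance_treatment_outcome_med :
    cov[X, Y; P] = betaMed P Y X W₁ * cov[X, X; P] +
      cov[X, lin (gammaOneMed P Y X W₁) W₁; P] := by
  rw [← hA.covariance_med _ hA.memLp_X]
  exact (covariance_fitted Y hA.memLp_medRegs hA.posDef_med (Sum.inl ())).symm

theorem covariance_treatment_outcome_long :
    cov[X, Y; P] = betaLong P Y X W₁ W₂ * cov[X, X; P] +
      (cov[X, lin (gammaOneLong P Y X W₁ W₂) W₁; P] +
        gammaTwoLong P Y X W₁ W₂ * cov[X, W₂; P]) := by
  rw [← hA.covariance_long _ hA.memLp_X]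
  exact (covariance_fitted Y hA.memLp_longRegs hA.posDef_long (Sum.inl ())).symm

theorem covariance_W₂_outcome :
    cov[Y, W₂; P] = betaLong P Y X W₁ W₂ * cov[X, W₂; P] + gammaTwoLong P Y X W₁ W₂ := by
  have h := hA.covariance_long _ hA.memLp_W₂
  rw [covariance_comm W₂ (lin _ W₁), hA.covariance_lin_W₂,
    covariance_self hA.memLp_W₂.aemeasurable, hA.norm_W₂, covariance_comm W₂ X] at h
  rw [covariance_comm]
  refine (covariance_fitted Y hA.memLp_longRegs hA.posDef_long (Sum.inr (Sum.inr ()))).symm.trans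
    (h.trans ?_)
  ring

/-- Omitted variable formula for the coefficients on the controls. -/
theorem gammaOneLong_eq :
    gammaOneLong P Y X W₁ W₂ = gammaOneMed P Y X W₁ +
      (betaMed P Y X W₁ - betaLong P Y X W₁ W₂) • piOne P X W₁ := by
  set B := betaMed P Y X W₁ - betaLong P Y X W₁ W₂ with hB
  by_contra hne
  -- If u were nonzero, u'W₁ would have positive variance; yet the medium, long and π₁ normal
  -- equations tested against u'W₁ make that variance zero.
  set u := gammaOneLong P Y X W₁ W₂ - (gammaOneMed P Y X W₁ + B • piOne P X W₁) with hu
  have hpos := variance_lin_pos hA.memLp_W₁ hA.posDef_controls (sub_ne_zero.2 hne)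
  rw [← hu] at hpos
  have hlin : lin u W₁ = (lin (gammaOneLong P Y X W₁ W₂) W₁ -
      (lin (gammaOneMed P Y X W₁) W₁ + B • lin (piOne P X W₁) W₁) : Ω → ℝ) := by
    ext ω
    simp only [hu, lin, Pi.sub_apply, Pi.add_apply, Pi.smul_apply, smul_eq_mul, Finset.mul_sum,
      ← Finset.sum_add_distrib, ← Finset.sum_sub_distrib]
    exact Finset.sum_congr rfl fun i _ => by ring
  have hm := memLp_lin (P := P) hA.memLp_W₁
  have h1 := hA.covariance_lin_outcome_med u
  have h2 := hA.covariance_lin_outcome_long u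
  have h3 := hA.covariance_lin_piOne u
  have h4 : cov[lin u W₁, lin u W₁; P] = cov[lin u W₁, lin (gammaOneLong P Y X W₁ W₂) W₁; P] -
      (cov[lin u W₁, lin (gammaOneMed P Y X W₁) W₁; P] +
        B * cov[lin u W₁, lin (piOne P X W₁) W₁; P]) := by
    -- Only the second slot is expanded; the first stays u'W₁, as in the normal equations.
    conv_lhs => arg 2; rw [hlin]
    rw [covariance_sub_right (hm u) (hm _) ((hm _).add ((hm _).const_smul _)),
      covariance_add_right (hm u) (hm _) ((hm _).const_smul _), covariance_smul_right]
  rw [h3] at h4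
  refine hpos.ne' ?_
  rw [h4, hB]
  linarith

theorem covariance_gammaOneLong (Z : Ω → ℝ) (hZ : MemLp Z 2 P) :
    cov[Z, lin (gammaOneLong P Y X W₁ W₂) W₁; P] = cov[Z, lin (gammaOneMed P Y X W₁) W₁; P] +
      (betaMed P Y X W₁ - betaLong P Y X W₁ W₂) * cov[Z, lin (piOne P X W₁) W₁; P] := by
  simp only [hA.gammaOneLong_eq, covariance_lin_right hA.memLp_W₁ hZ, Finset.mul_sum,
    ← Finset.sum_add_distrib]
  exact Finset.sum_congr rfl fun i _ => by simp; ring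

theorem covariance_treatment_piOne :
    cov[X, lin (piOne P X W₁) W₁; P] = Var[lin (piOne P X W₁) W₁; P] := by
  rw [← covariance_self (memLp_lin hA.memLp_W₁ _).aemeasurable, hA.covariance_lin_piOne,
    covariance_comm]

/-- Pythagoras: π₁'W₁ is the projection of X on the controls. -/
theorem variance_xPerp :
    Var[xPerp P X W₁; P] = cov[X, X; P] - Var[lin (piOne P X W₁) W₁; P] := by
  have hm := memLp_lin (P := P) hA.memLp_W₁ (piOne P X W₁)
  have hx : xPerp P X W₁ = X - lin (piOne P X W₁) W₁ := rfl
  rw [hx, ← covariance_self (hA.memLp_X.sub hm).aemeasurable,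
    covariance_sub_sub hA.memLp_X hm hA.memLp_X hm, covariance_comm (lin _ W₁) X,
    hA.covariance_treatment_piOne, covariance_self hm.aemeasurable]
  ring

/-- Variance of the long index of the observed controls. -/
theorem variance_gammaOneLong :
    Var[lin (gammaOneLong P Y X W₁ W₂) W₁; P] =
      Var[lin (gammaOneMed P Y X W₁) W₁; P] +
        2 * (betaMed P Y X W₁ - betaLong P Y X W₁ W₂) *
          cov[X, lin (gammaOneMed P Y X W₁) W₁; P] +
        (betaMed P Y X W₁ - betaLong P Y X W₁ W₂) ^ 2 * Var[lin (piOne P X W₁) W₁; P] := by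
  have hm := memLp_lin (P := P) hA.memLp_W₁
  rw [← covariance_self (hm _).aemeasurable, hA.covariance_gammaOneLong _ (hm _),
    covariance_comm _ (lin (gammaOneMed P Y X W₁) W₁),
    covariance_comm _ (lin (piOne P X W₁) W₁), hA.covariance_gammaOneLong _ (hm _),
    hA.covariance_gammaOneLong _ (hm _), hA.covariance_lin_piOne,
    covariance_comm (lin (piOne P X W₁) W₁) (lin (gammaOneMed P Y X W₁) W₁),
    hA.covariance_lin_piOne, covariance_comm _ X, covariance_self (hm _).aemeasurable,
    covariance_self (hm _).aemeasurable]
  ring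

theorem variance_gammaOneLong_pos : 0 < Var[lin (gammaOneLong P Y X W₁ W₂) W₁; P] := by
  rw [← covariance_self (memLp_lin hA.memLp_W₁ _).aemeasurable]
  exact variance_lin_pos hA.memLp_W₁ hA.posDef_controls hA.gammaOne_ne

/-- Omitted variable bias of the medium regression. -/
theorem omitted_variable_bias :
    (betaMed P Y X W₁ - betaLong P Y X W₁ W₂) * Var[xPerp P X W₁; P] =
      gammaTwoLong P Y X W₁ W₂ * cov[X, W₂; P] := by
  have h1 := hA.covariance_treatment_outcome_med
  have h2 := hA.covariance_treatment_outcome_long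
  rw [hA.covariance_gammaOneLong _ hA.memLp_X, hA.covariance_treatment_piOne] at h2
  rw [hA.variance_xPerp]
  linarith

/-- The gain in explained variance from the unobserved control. -/
theorem gammaTwoLong_sq :
    gammaTwoLong P Y X W₁ W₂ ^ 2 =
      (rSqLong P Y X W₁ W₂ - rSqMed P Y X W₁) * Var[Y; P] +
        (betaMed P Y X W₁ - betaLong P Y X W₁ W₂) ^ 2 * Var[xPerp P X W₁; P] := by
  have hv := hA.variance_outcome_pos.ne'
  have hm := memLp_lin (P := P) hA.memLp_W₁
  have h1 := rSquared_mul_variance hA.memLp_Y hA.memLp_medRegs hA.posDef_med hv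
  have h2 := rSquared_mul_variance hA.memLp_Y hA.memLp_longRegs hA.posDef_long hv
  rw [covariance_comm, hA.covariance_med _ hA.memLp_Y] at h1
  rw [covariance_comm, hA.covariance_long _ hA.memLp_Y,
    hA.covariance_gammaOneLong _ hA.memLp_Y, hA.covariance_W₂_outcome] at h2
  have h3 := hA.covariance_lin_outcome_med (piOne P X W₁)
  rw [covariance_comm _ Y, covariance_comm _ X, hA.covariance_treatment_piOne,
    covariance_comm _ (lin (gammaOneMed P Y X W₁) W₁), hA.covariance_lin_piOne,
    covariance_comm _ X] at h3
  rw [covariance_comm Y X, hA.covariance_treatment_outcome_med] at h1 h2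
  rw [h3] at h2
  have h4 := hA.omitted_variable_bias
  rw [hA.variance_xPerp] at h4 ⊢
  rw [sub_mul, rSqLong, rSqMed, h1, h2]
  -- Since β_med − B = β_long, what remains is β_long times the omitted variable bias identity.
  linear_combination betaLong P Y X W₁ W₂ * h4

theorem fZero_eq :
    fZero P Y X W₁ (betaMed P Y X W₁ - betaLong P Y X W₁ W₂) =
      -((betaMed P Y X W₁ - betaLong P Y X W₁ W₂) * Var[xPerp P X W₁; P] *
        Var[lin (gammaOneLong P Y X W₁ W₂) W₁; P]) := by
  rw [fZero, hA.variance_gammaOneLong]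
  ring

/-- The cubic factors as ((R² − R²_med) var(Y) + B² var(X^{⊥W₁})) (cov(X, γ₁,med'W₁) + B
var(π₁'W₁)). -/
theorem fOne_eq :
    fOne P Y X W₁ (betaMed P Y X W₁ - betaLong P Y X W₁ W₂) (rSqLong P Y X W₁ W₂) =
      gammaTwoLong P Y X W₁ W₂ ^ 2 * cov[X, lin (gammaOneLong P Y X W₁ W₂) W₁; P] := by
  rw [fOne, hA.gammaTwoLong_sq, hA.covariance_gammaOneLong _ hA.memLp_X,
    hA.covariance_treatment_piOne]
  ring

/-- The selection equation in terms of the distribution of the observables. -/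
theorem mul_fOne_eq_neg_fZero :
    δ * fOne P Y X W₁ (betaMed P Y X W₁ - betaLong P Y X W₁ W₂) (rSqLong P Y X W₁ W₂) =
      -fZero P Y X W₁ (betaMed P Y X W₁ - betaLong P Y X W₁ W₂) := by
  have h := hA.selection
  have hγ := hA.gammaTwo_ne
  have hV := hA.variance_gammaOneLong_pos.ne'
  -- By A5 the right side of A2 is γ₂ cov(X, W₂) / γ₂², whose numerator is B var(X^{⊥W₁}).
  rw [covariance_const_mul_right, variance_const_mul, hA.norm_W₂, mul_one,
    ← hA.omitted_variable_bias] at h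
  rw [hA.fOne_eq, hA.fZero_eq]
  field_simp at h
  linear_combination h

/-- Equates the short and medium expressions for cov(X, Y); it turns β_short ≠ β_med into cov(X,
γ₁,med'W₁) ≠ 0. -/
theorem betaShort_sub_betaMed :
    (betaShort P Y X - betaMed P Y X W₁) * cov[X, X; P] =
      cov[X, lin (gammaOneMed P Y X W₁) W₁; P] := by
  have h : cov[X, lin (olsCoef P Y (shortRegs X)) (shortRegs X); P] = cov[X, Y; P] :=
    covariance_fitted Y (fun _ => hA.memLp_X) hA.posDef_short ()
  rw [covariance_lin_right (V := shortRegs X) (fun _ => hA.memLp_X) hA.memLp_X] at h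
  simp only [Finset.univ_unique, Finset.sum_singleton] at h
  change betaShort P Y X * cov[X, X; P] = _ at h
  rw [hA.covariance_treatment_outcome_med] at h
  linarith

theorem fOne_ne_zero (hne : betaShort P Y X ≠ betaMed P Y X W₁) :
    fOne P Y X W₁ (betaMed P Y X W₁ - betaLong P Y X W₁ W₂) (rSqLong P Y X W₁ W₂) ≠ 0 := by
  intro h1
  have h := hA.mul_fOne_eq_neg_fZero
  rw [h1, mul_zero, hA.fZero_eq, neg_neg] at h
  -- f₀ = 0 forces B = 0, because both variances in `fZero_eq` are positive.
  have hB : betaMed P Y X W₁ - betaLong P Y X W₁ W₂ = 0 := by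
    simpa [hA.variance_xPerp_pos.ne', hA.variance_gammaOneLong_pos.ne'] using h.symm
  rw [hA.fOne_eq, hA.covariance_gammaOneLong _ hA.memLp_X, hB, zero_mul, add_zero,
    ← hA.betaShort_sub_betaMed] at h1
  simp [hA.gammaTwo_ne, hA.variance_treatment_pos.ne', sub_eq_zero, hne] at h1

end Assumptions

end Core

/-! ### Transport along a map and dependence on laws only -/

section Transfer

variable {Ω Ω' : Type*} [MeasurableSpace Ω] [MeasurableSpace Ω'] {P : Measure Ω} {T : Ω → Ω'}
  {d : ℕ} {ι : Type*} [Fintype ι] {Y X : Ω' → ℝ} {W₁ : Fin d → Ω' → ℝ} {W₂ : Ω' → ℝ}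

/-- The map is only a.e. measurable because `MemLp` gives no more for the given variables; the
functions on the target will be coordinate projections and their indices, which are measurable. -/
theorem covariance_map_of_measurable (hT : AEMeasurable T P) {f g : Ω' → ℝ} (hf : Measurable f)
    (hg : Measurable g) : cov[f, g; P.map T] = cov[f ∘ T, g ∘ T; P] :=
  covariance_map hf.aestronglyMeasurable hg.aestronglyMeasurable hT

theorem variance_map_of_measurable (hT : AEMeasurable T P) {f : Ω' → ℝ} (hf : Measurable f) :
    Var[f; P.map T] = Var[f ∘ T; P] :=
  variance_map hf.aemeasurable hT

theorem measurable_lin {V : ι → Ω' → ℝ} (hV : ∀ i, Measurable (V i)) (g : ι → ℝ) :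
    Measurable (lin g V) :=
  Finset.measurable_sum _ fun i _ => (hV i).const_mul (g i)

theorem varMatrix_map {κ : Type*} (hT : AEMeasurable T P) {V : κ → Ω' → ℝ}
    (hV : ∀ i, Measurable (V i)) :
    varMatrix (P.map T) V = varMatrix P fun i => V i ∘ T := by
  ext i j
  exact covariance_map_of_measurable hT (hV i) (hV j)

theorem olsCoef_map [DecidableEq ι] (hT : AEMeasurable T P) (hY : Measurable Y) {V : ι → Ω' → ℝ}
    (hV : ∀ i, Measurable (V i)) :
    olsCoef (P.map T) Y V = olsCoef P (Y ∘ T) fun i => V i ∘ T := by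
  simp only [olsCoef, varMatrix_map hT hV, covariance_map_of_measurable hT (hV _) hY]

theorem rSquared_map [DecidableEq ι] (hT : AEMeasurable T P) (hY : Measurable Y) {V : ι → Ω' → ℝ}
    (hV : ∀ i, Measurable (V i)) :
    rSquared (P.map T) Y V = rSquared P (Y ∘ T) fun i => V i ∘ T := by
  rw [rSquared, variance_map_of_measurable hT (measurable_lin hV _),
    variance_map_of_measurable hT hY, olsCoef_map hT hY hV]
  rfl

theorem measurable_medRegs (hX : Measurable X) (hW₁ : ∀ i, Measurable (W₁ i)) :
    ∀ i, Measurable (medRegs X W₁ i) := by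
  rintro (_ | i)
  exacts [hX, hW₁ i]

theorem measurable_longRegs (hX : Measurable X) (hW₁ : ∀ i, Measurable (W₁ i))
    (hW₂ : Measurable W₂) : ∀ i, Measurable (longRegs X W₁ W₂ i) := by
  rintro (_ | _ | _)
  exacts [hX, hW₁ _, hW₂]

theorem olsCoef_medRegs_map (hT : AEMeasurable T P) (hY : Measurable Y) (hX : Measurable X)
    (hW₁ : ∀ i, Measurable (W₁ i)) :
    olsCoef (P.map T) Y (medRegs X W₁) =
      olsCoef P (Y ∘ T) (medRegs (X ∘ T) fun i => W₁ i ∘ T) := by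
  rw [olsCoef_map hT hY (measurable_medRegs hX hW₁), medRegs_comp]

theorem olsCoef_longRegs_map (hT : AEMeasurable T P) (hY : Measurable Y) (hX : Measurable X)
    (hW₁ : ∀ i, Measurable (W₁ i)) (hW₂ : Measurable W₂) :
    olsCoef (P.map T) Y (longRegs X W₁ W₂) =
      olsCoef P (Y ∘ T) (longRegs (X ∘ T) (fun i => W₁ i ∘ T) (W₂ ∘ T)) := by
  rw [olsCoef_map hT hY (measurable_longRegs hX hW₁ hW₂), longRegs_comp]

theorem betaMed_map (hT : AEMeasurable T P) (hY : Measurable Y) (hX : Measurable X)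
    (hW₁ : ∀ i, Measurable (W₁ i)) :
    betaMed (P.map T) Y X W₁ = betaMed P (Y ∘ T) (X ∘ T) fun i => W₁ i ∘ T :=
  congrFun (olsCoef_medRegs_map hT hY hX hW₁) _

theorem gammaOneMed_map (hT : AEMeasurable T P) (hY : Measurable Y) (hX : Measurable X)
    (hW₁ : ∀ i, Measurable (W₁ i)) :
    gammaOneMed (P.map T) Y X W₁ = gammaOneMed P (Y ∘ T) (X ∘ T) fun i => W₁ i ∘ T :=
  funext fun _ => congrFun (olsCoef_medRegs_map hT hY hX hW₁) _

theorem rSqMed_map (hT : AEMeasurable T P) (hY : Measurable Y) (hX : Measurable X)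
    (hW₁ : ∀ i, Measurable (W₁ i)) :
    rSqMed (P.map T) Y X W₁ = rSqMed P (Y ∘ T) (X ∘ T) fun i => W₁ i ∘ T := by
  rw [rSqMed, rSquared_map hT hY (measurable_medRegs hX hW₁), medRegs_comp, rSqMed]

theorem piOne_map (hT : AEMeasurable T P) (hX : Measurable X) (hW₁ : ∀ i, Measurable (W₁ i)) :
    piOne (P.map T) X W₁ = piOne P (X ∘ T) fun i => W₁ i ∘ T :=
  olsCoef_map hT hX hW₁

theorem variance_xPerp_map (hT : AEMeasurable T P) (hX : Measurable X)
    (hW₁ : ∀ i, Measurable (W₁ i)) :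
    Var[xPerp (P.map T) X W₁; P.map T] = Var[xPerp P (X ∘ T) fun i => W₁ i ∘ T; P] := by
  have hm : Measurable (xPerp (P.map T) X W₁) := hX.sub (measurable_lin hW₁ _)
  rw [variance_map_of_measurable hT hm]
  unfold xPerp
  rw [piOne_map hT hX hW₁]
  rfl

theorem variance_lin_map (hT : AEMeasurable T P) {V : ι → Ω' → ℝ} (hV : ∀ i, Measurable (V i))
    (g : ι → ℝ) : Var[lin g V; P.map T] = Var[lin g fun i => V i ∘ T; P] :=
  variance_map_of_measurable hT (measurable_lin hV g)

theorem covariance_lin_map (hT : AEMeasurable T P) (hX : Measurable X) {V : ι → Ω' → ℝ}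
    (hV : ∀ i, Measurable (V i)) (g : ι → ℝ) :
    cov[X, lin g V; P.map T] = cov[X ∘ T, lin g fun i => V i ∘ T; P] :=
  covariance_map_of_measurable hT hX (measurable_lin hV g)

theorem fZero_map (hT : AEMeasurable T P) (hY : Measurable Y) (hX : Measurable X)
    (hW₁ : ∀ i, Measurable (W₁ i)) :
    fZero (P.map T) Y X W₁ = fZero P (Y ∘ T) (X ∘ T) fun i => W₁ i ∘ T := by
  funext B
  simp only [fZero, variance_xPerp_map hT hX hW₁, gammaOneMed_map hT hY hX hW₁,
    piOne_map hT hX hW₁, variance_lin_map hT hW₁, covariance_lin_map hT hX hW₁]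

theorem fOne_map (hT : AEMeasurable T P) (hY : Measurable Y) (hX : Measurable X)
    (hW₁ : ∀ i, Measurable (W₁ i)) :
    fOne (P.map T) Y X W₁ = fOne P (Y ∘ T) (X ∘ T) fun i => W₁ i ∘ T := by
  funext B R2
  simp only [fOne, variance_xPerp_map hT hX hW₁, gammaOneMed_map hT hY hX hW₁,
    piOne_map hT hX hW₁, variance_lin_map hT hW₁, covariance_lin_map hT hX hW₁,
    rSqMed_map hT hY hX hW₁, variance_map_of_measurable hT hY]

theorem betaLong_map (hT : AEMeasurable T P) (hY : Measurable Y) (hX : Measurable X)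
    (hW₁ : ∀ i, Measurable (W₁ i)) (hW₂ : Measurable W₂) :
    betaLong (P.map T) Y X W₁ W₂ = betaLong P (Y ∘ T) (X ∘ T) (fun i => W₁ i ∘ T) (W₂ ∘ T) :=
  congrFun (olsCoef_longRegs_map hT hY hX hW₁ hW₂) _

theorem gammaOneLong_map (hT : AEMeasurable T P) (hY : Measurable Y) (hX : Measurable X)
    (hW₁ : ∀ i, Measurable (W₁ i)) (hW₂ : Measurable W₂) :
    gammaOneLong (P.map T) Y X W₁ W₂ =
      gammaOneLong P (Y ∘ T) (X ∘ T) (fun i => W₁ i ∘ T) (W₂ ∘ T) :=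
  funext fun _ => congrFun (olsCoef_longRegs_map hT hY hX hW₁ hW₂) _

theorem gammaTwoLong_map (hT : AEMeasurable T P) (hY : Measurable Y) (hX : Measurable X)
    (hW₁ : ∀ i, Measurable (W₁ i)) (hW₂ : Measurable W₂) :
    gammaTwoLong (P.map T) Y X W₁ W₂ =
      gammaTwoLong P (Y ∘ T) (X ∘ T) (fun i => W₁ i ∘ T) (W₂ ∘ T) :=
  congrFun (olsCoef_longRegs_map hT hY hX hW₁ hW₂) _

theorem rSqLong_map (hT : AEMeasurable T P) (hY : Measurable Y) (hX : Measurable X)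
    (hW₁ : ∀ i, Measurable (W₁ i)) (hW₂ : Measurable W₂) :
    rSqLong (P.map T) Y X W₁ W₂ =
      rSqLong P (Y ∘ T) (X ∘ T) (fun i => W₁ i ∘ T) (W₂ ∘ T) := by
  rw [rSqLong, rSquared_map hT hY (measurable_longRegs hX hW₁ hW₂), longRegs_comp, rSqLong]

/-- The assumptions depend on the random variables only through their joint distribution. -/
theorem Assumptions.map {δ : ℝ} (hT : AEMeasurable T P) (hY : Measurable Y) (hX : Measurable X)
    (hW₁ : ∀ i, Measurable (W₁ i)) (hW₂ : Measurable W₂)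
    (hA : Assumptions P (Y ∘ T) (X ∘ T) (fun i => W₁ i ∘ T) (W₂ ∘ T) δ) :
    Assumptions (P.map T) Y X W₁ W₂ δ where
  memLp_Y := (memLp_map_measure_iff hY.aestronglyMeasurable hT).2 hA.memLp_Y
  memLp_X := (memLp_map_measure_iff hX.aestronglyMeasurable hT).2 hA.memLp_X
  memLp_W₁ i := (memLp_map_measure_iff (hW₁ i).aestronglyMeasurable hT).2 (hA.memLp_W₁ i)
  memLp_W₂ := (memLp_map_measure_iff hW₂.aestronglyMeasurable hT).2 hA.memLp_W₂
  posDef_long := by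
    rw [varMatrix_map hT (measurable_longRegs hX hW₁ hW₂), longRegs_comp]
    exact hA.posDef_long
  posDef_obs := by
    rw [varMatrix_map hT]
    · convert hA.posDef_obs using 2
      funext i
      rcases i with _ | _ | _ <;> rfl
    · rintro (_ | i)
      exacts [hY, measurable_medRegs hX hW₁ i]
  selection := by
    rw [gammaOneLong_map hT hY hX hW₁ hW₂, gammaTwoLong_map hT hY hX hW₁ hW₂,
      covariance_lin_map hT hX hW₁, variance_lin_map hT hW₁,
      covariance_map_of_measurable hT hX (hW₂.const_mul _),
      variance_map_of_measurable hT (hW₂.const_mul _)]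
    exact hA.selection
  gammaOne_ne := by
    rw [gammaOneLong_map hT hY hX hW₁ hW₂]
    exact hA.gammaOne_ne
  gammaTwo_ne := by
    rw [gammaTwoLong_map hT hY hX hW₁ hW₂]
    exact hA.gammaTwo_ne
  exog i := by
    rw [covariance_map_of_measurable hT (hW₁ i) hW₂]
    exact hA.exog i
  norm_W₂ := by
    rw [variance_map_of_measurable hT hW₂]
    exact hA.norm_W₂

/-- The observed marginal of the joint distribution of `(Y, X, W₁, W₂)`. -/
theorem obsLaw_map_coords {Y X : Ω → ℝ} {W₁ : Fin d → Ω → ℝ} {W₂ : Ω → ℝ}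
    (hT : AEMeasurable (fun ω => (Y ω, X ω, (fun i => W₁ i ω), W₂ ω)) P) :
    obsLaw (P.map fun ω => (Y ω, X ω, (fun i => W₁ i ω), W₂ ω)) (fun q => q.1) (fun q => q.2.1)
      (fun i q => q.2.2.1 i) = obsLaw P Y X W₁ := by
  unfold obsLaw
  rw [AEMeasurable.map_map_of_aemeasurable (by fun_prop) hT]
  rfl

theorem aemeasurable_obs {Y X : Ω → ℝ} {W₁ : Fin d → Ω → ℝ} {W₂ : Ω → ℝ} {δ : ℝ}
    (hA : Assumptions P Y X W₁ W₂ δ) : AEMeasurable (fun ω => (Y ω, X ω, fun i => W₁ i ω)) P :=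
  hA.memLp_Y.aemeasurable.prodMk (hA.memLp_X.aemeasurable.prodMk
    (aemeasurable_pi_lambda _ fun i => (hA.memLp_W₁ i).aemeasurable))

theorem aemeasurable_joint {Y X : Ω → ℝ} {W₁ : Fin d → Ω → ℝ} {W₂ : Ω → ℝ} {δ : ℝ}
    (hA : Assumptions P Y X W₁ W₂ δ) :
    AEMeasurable (fun ω => (Y ω, X ω, (fun i => W₁ i ω), W₂ ω)) P :=
  hA.memLp_Y.aemeasurable.prodMk (hA.memLp_X.aemeasurable.prodMk
    ((aemeasurable_pi_lambda _ fun i => (hA.memLp_W₁ i).aemeasurable).prodMk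
      hA.memLp_W₂.aemeasurable))

/-- The parameters of a model are compatible with the distribution of its observables. -/
theorem Assumptions.compatible [IsProbabilityMeasure P] {Y X : Ω → ℝ} {W₁ : Fin d → Ω → ℝ}
    {W₂ : Ω → ℝ} {δ : ℝ} (hA : Assumptions P Y X W₁ W₂ δ) :
    Compatible (obsLaw P Y X W₁) δ (rSqLong P Y X W₁ W₂) (betaLong P Y X W₁ W₂) := by
  have hT := aemeasurable_joint hA
  have hY : Measurable fun q : ℝ × ℝ × (Fin d → ℝ) × ℝ => q.1 := by fun_prop
  have hX : Measurable fun q : ℝ × ℝ × (Fin d → ℝ) × ℝ => q.2.1 := by fun_prop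
  have hW₁ : ∀ i, Measurable fun q : ℝ × ℝ × (Fin d → ℝ) × ℝ => q.2.2.1 i := by fun_prop
  have hW₂ : Measurable fun q : ℝ × ℝ × (Fin d → ℝ) × ℝ => q.2.2.2 := by fun_prop
  exact ⟨P.map _, Measure.isProbabilityMeasure_map hT, obsLaw_map_coords hT,
    Assumptions.map hT hY hX hW₁ hW₂ hA, rSqLong_map hT hY hX hW₁ hW₂,
    betaLong_map hT hY hX hW₁ hW₂⟩

/-- Functionals of the observables as functionals of their distribution. -/
theorem obsLaw_functionals {Y X : Ω → ℝ} {W₁ : Fin d → Ω → ℝ}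
    (hT : AEMeasurable (fun ω => (Y ω, X ω, fun i => W₁ i ω)) P) :
    betaMed (obsLaw P Y X W₁) (fun q => q.1) (fun q => q.2.1) (fun i q => q.2.2 i) =
        betaMed P Y X W₁ ∧
      fZero (obsLaw P Y X W₁) (fun q => q.1) (fun q => q.2.1) (fun i q => q.2.2 i) =
        fZero P Y X W₁ ∧
      fOne (obsLaw P Y X W₁) (fun q => q.1) (fun q => q.2.1) (fun i q => q.2.2 i) =
        fOne P Y X W₁ := by
  have hY : Measurable fun q : ℝ × ℝ × (Fin d → ℝ) => q.1 := by fun_prop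
  have hX : Measurable fun q : ℝ × ℝ × (Fin d → ℝ) => q.2.1 := by fun_prop
  have hW₁ : ∀ i, Measurable fun q : ℝ × ℝ × (Fin d → ℝ) => q.2.2 i := by fun_prop
  exact ⟨betaMed_map hT hY hX hW₁, fZero_map hT hY hX hW₁, fOne_map hT hY hX hW₁⟩

/-- Every compatible triple satisfies the selection equation in terms of the observables. -/
theorem Compatible.mul_fOne_eq_neg_fZero {Y X : Ω → ℝ} {W₁ : Fin d → Ω → ℝ} {δ R2 b : ℝ}
    (hT : AEMeasurable (fun ω => (Y ω, X ω, fun i => W₁ i ω)) P)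
    (h : Compatible (obsLaw P Y X W₁) δ R2 b) :
    δ * fOne P Y X W₁ (betaMed P Y X W₁ - b) R2 = -fZero P Y X W₁ (betaMed P Y X W₁ - b) := by
  obtain ⟨Q, hQ, hL, hA, rfl, rfl⟩ := h
  obtain ⟨hβ, h0, h1⟩ := obsLaw_functionals hT
  obtain ⟨hβ', h0', h1'⟩ := obsLaw_functionals (aemeasurable_obs hA)
  -- Passing through the common law of the observables replaces the functionals under P by those
  -- under Q, where A1–A5 hold.
  rw [← hβ, ← h0, ← h1, ← hL, hβ', h0', h1']
  exact hA.mul_fOne_eq_neg_fZero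

end Transfer

/-! ### Breakdown points and the conclusion -/

theorem exactBreakdown_of_eq_singleton {𝓑 : ℝ → Set ℝ} {b δ₀ : ℝ} (h : {δ | b ∈ 𝓑 δ} = {δ₀}) :
    exactBreakdown 𝓑 b = ((|δ₀| : ℝ) : EReal) := by
  rw [exactBreakdown, h, Set.image_singleton, sInf_singleton]

end Oster

theorem mainTheorem4 {Ω : Type*} [MeasurableSpace Ω] (P : Measure Ω) [IsProbabilityMeasure P]
    {d : ℕ} (Y X : Ω → ℝ) (W₁ : Fin d → Ω → ℝ) (W₂ : Ω → ℝ) (δ R2 βhypo : ℝ)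
    (hA : Oster.Assumptions P Y X W₁ W₂ δ)
    (hR2 : Oster.rSqLong P Y X W₁ W₂ = R2)
    (hR2mem : R2 ∈ Set.Ioc (Oster.rSqMed P Y X W₁) 1)
    (hβ : Oster.betaLong P Y X W₁ W₂ = βhypo)
    (hβfail : βhypo ∉ Oster.A3fail P Y X W₁)
    (hne : Oster.betaShort P Y X ≠ Oster.betaMed P Y X W₁) :
    Oster.fOne P Y X W₁ (Oster.betaMed P Y X W₁ - βhypo) R2 ≠ 0 ∧
    δ = -Oster.fZero P Y X W₁ (Oster.betaMed P Y X W₁ - βhypo) /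
          Oster.fOne P Y X W₁ (Oster.betaMed P Y X W₁ - βhypo) R2 ∧
    Oster.idSetDelta (Oster.obsLaw P Y X W₁) R2 βhypo =
      {-Oster.fZero P Y X W₁ (Oster.betaMed P Y X W₁ - βhypo) /
          Oster.fOne P Y X W₁ (Oster.betaMed P Y X W₁ - βhypo) R2} ∧
    Oster.exactBreakdown (fun δ' => Oster.setBI P Y X W₁ δ' R2) βhypo =
      ((|-Oster.fZero P Y X W₁ (Oster.betaMed P Y X W₁ - βhypo) /
          Oster.fOne P Y X W₁ (Oster.betaMed P Y X W₁ - βhypo) R2| : ℝ) : EReal) ∧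
    Oster.exactBreakdown (fun δ' => Oster.idSetBeta (Oster.obsLaw P Y X W₁) δ' R2) βhypo =
      ((|-Oster.fZero P Y X W₁ (Oster.betaMed P Y X W₁ - βhypo) /
          Oster.fOne P Y X W₁ (Oster.betaMed P Y X W₁ - βhypo) R2| : ℝ) : EReal) := by
  subst hR2 hβ
  have hf := hA.fOne_ne_zero hne
  have hδ := eq_div_of_mul_eq hf hA.mul_fOne_eq_neg_fZero
  have hset : Oster.idSetDelta (Oster.obsLaw P Y X W₁) (Oster.rSqLong P Y X W₁ W₂)
      (Oster.betaLong P Y X W₁ W₂) = {δ} := by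
    refine Set.eq_singleton_iff_unique_mem.2 ⟨hA.compatible, fun δ' h => ?_⟩
    exact (eq_div_of_mul_eq hf (h.mul_fOne_eq_neg_fZero (Oster.aemeasurable_obs hA))).trans hδ.symm
  rw [← hδ]
  refine ⟨hf, rfl, hset, Oster.exactBreakdown_of_eq_singleton ?_,
    -- b ∈ `idSetBeta L δ' R2` and δ' ∈ `idSetDelta L R2 b` both unfold to the same compatibility
    -- statement, so `hset` serves again.
    Oster.exactBreakdown_of_eq_singleton hset⟩
  refine Set.eq_singleton_iff_unique_mem.2 ⟨⟨?_, hβfail⟩, fun δ' h => ?_⟩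
  · show _ + _ = _
    rw [hA.mul_fOne_eq_neg_fZero, add_neg_cancel]
  -- Membership in the closed-form set supplies f₀ + δ' f₁ = 0, again linear in δ' with f₁ ≠ 0.
  · exact (eq_div_of_mul_eq hf (eq_neg_of_add_eq_zero_right h.1)).trans hδ.symm
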